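/- Let $\mathsf H$ be a finite connected $\Delta$-regular graph with $\Delta\ge 2$, with $v_{\mathsf H}$ vertices and $e(\mathsf H)$ edges. For a graph $\mathsf G$, let $N(\mathsf H,\mathsf G)$ be the number of labelled copies of $\mathsf H$ in $\mathsf G$, i.e. of injective maps $V(\mathsf H)\to V(\mathsf G)$ that send edges to edges, and, for an edge $e$ of $\mathsf G$, let $N(\mathsf H,\mathsf G,e)$ be the number of labelled copies that contain $e$ (i.e. some edge of $\mathsf H$ is mapped to $e$). Given $\delta,\varepsilon,\bar C>0$, $n\in\mathbb N$ and $p\in(0,1)$, a graph $\mathsf G\subset K_n$ is called a *core graph* if (C1) $N(\mathsf H,\mathsf G)\ge \delta(1-3\varepsilon)n^{v_{\mathsf H}}p^{e(\mathsf H)}$; (C2) $e(\mathsf G)\le \bar C n^2p^\Delta\log(1/p)$; (C3) $N(\mathsf H,\mathsf G,e)\ge \delta\varepsilon\, n^{v_{\mathsf H}}p^{e(\mathsf H)}/(\bar C n^2p^\Delta\log(1/p))$ for every edge $e$ of $\mathsf G$. Let $\mathbb G(n,p)$ be the binomial (Erdős–Rényi) random graph on $n$ vertices and let $\mathrm{Core}_2$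 be the event that there is a core graph $\mathsf G\subset\mathbb G(n,p)$ with $$\frac{\bar C n^2p^\Delta\log(1/p)}{(\log\log n)^2}\le e(\mathsf G)\le \bar C n^2p^\Delta\log(1/p).$$ **Proposition.** There is a nonnegative function $\mathfrak f_{\mathsf H}$, depending only on $\mathsf H$, with $\lim_{\varepsilon\downarrow0}\mathfrak f_{\mathsf H}(\varepsilon)=0$ such that the following holds. For every $\delta>0$ there is $\varepsilon_0>0$ (depending only on $\delta$ and $\mathsf H$) such that for every $\varepsilon\in(0,\varepsilon_0)$, every constant $\bar C>0$ and every sequence $p=p_n\in(0,1)$ with $(\log n)^{1/(v_{\mathsf H}-2)}=o(np^{\Delta/2})$ as $n\to\infty$ and $np^{\Delta/2}\le(\log n)^{v_{\mathsf H}}$ for all large $n$, $$\limsup_{n\to\infty}\frac{\log\mathbb P(\mathrm{Core}_2)}{n^2p^\Delta\log(1/p)}\le-\frac12\,\delta^{2/v_{\mathsf H}}\,(1-\mathfrak f_{\mathsf H}(\varepsilon)),$$ where $\log 0=-\infty$. -/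

import Mathlib

open Filter Topology Asymptotics

/-- The number `N(H, G, e)` of labelled copies of `H` in `G` (injective homomorphisms from `H`
to `G`) whose image contains the edge `e`. -/
noncomputable def labelledCopyCountThrough {V W : Type*} (H : SimpleGraph V) (G : SimpleGraph W)
    (e : Sym2 W) : ℕ :=
  Nat.card {φ : SimpleGraph.Copy H G // ∃ x y : V, H.Adj x y ∧ s(φ x, φ y) = e}

/-- The maximal number `C n² p ^ Δ log (1 / p)` of edges of a core graph. -/
noncomputable def coreEdgeBound (Δ n : ℕ) (p C : ℝ) : ℝ :=
  C * (n : ℝ) ^ 2 * p ^ Δ * Real.log (1 / p)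

/-- `G`, a subgraph of the complete graph on `n` vertices, is a core graph for the `Δ`-regular
graph `H`, with parameters `p`, `δ`, `ε` and `C`. -/
structure IsCoreGraph {V : Type*} [Fintype V] (H : SimpleGraph V) (Δ n : ℕ) (p δ ε C : ℝ)
    (G : SimpleGraph (Fin n)) : Prop where
  /-- `G` contains many labelled copies of `H`. -/
  copies : δ * (1 - 3 * ε) * (n : ℝ) ^ Fintype.card V * p ^ H.edgeSet.ncard ≤
    (G.labelledCopyCount H : ℝ)
  /-- `G` does not have too many edges. -/
  edges_le : (G.edgeSet.ncard : ℝ) ≤ coreEdgeBound Δ n p C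
  /-- Every edge of `G` lies in many labelled copies of `H`. -/
  copies_through : ∀ e ∈ G.edgeSet,
    δ * ε * (n : ℝ) ^ Fintype.card V * p ^ H.edgeSet.ncard / coreEdgeBound Δ n p C ≤
      (labelledCopyCountThrough H G e : ℝ)

/-- The event, as a set of graphs on `n` vertices, of containing a core graph `G` that satisfies
`C n² p ^ Δ log (1 / p) / (log log n)² ≤ e(G) ≤ C n² p ^ Δ log (1 / p)`. -/
def coreEvent {V : Type*} [Fintype V] (H : SimpleGraph V) (Δ n : ℕ) (p δ ε C : ℝ) :
    Set (SimpleGraph (Fin n)) :=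
  {Γ | ∃ G : SimpleGraph (Fin n), G ≤ Γ ∧ IsCoreGraph H Δ n p δ ε C G ∧
    coreEdgeBound Δ n p C / Real.log (Real.log n) ^ 2 ≤ (G.edgeSet.ncard : ℝ) ∧
    (G.edgeSet.ncard : ℝ) ≤ coreEdgeBound Δ n p C}

/-! Put s = n p^(Δ/2) and v = |V(H)|. The bound in (C3) is of order s^(v-2) / log(1/p), which tends
to infinity, so every edge of a core graph lies in more copies of `H` than a region of degrees at
most Δ can hold (`labelledCopyCountThrough_le`). Hence every edge is within bounded distance of a
vertex of degree above Δ. All non-isolated vertices have degree at least Δ, and the excess at the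
large ones is a fixed proportion of all edges. So m edges span at most (2 - c) m / Δ vertices, with
c > 0 depending only on `H` (`support_ncard_le`).

As m is polylogarithmic in n, there are at most n^((2 - c) m / Δ + o(m)) such graphs, and each is
contained in the random graph with probability p^m = n^(-2m/Δ + o(m)). The union bound
(`binomialRandom_coreEvent_le`) leaves n^(-c'm). For m at least C s^2 log(1/p) / (log log n)^2, the
exponent c' m log n exceeds every multiple of s^2 log(1/p). -/

namespace SimpleGraph

/-! ### Growth of iterated neighbourhoods. -/

section Neighborhoods

variable {W : Type*} [Fintype W] [DecidableEq W] (G : SimpleGraph W) [DecidableRel G.Adj]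

/-- The vertices that are in `S` or adjacent to a vertex of `S` that satisfies `P`. -/
def closedNeighbors (P : W → Prop) [DecidablePred P] (S : Finset W) : Finset W :=
  S ∪ (S.filter P).biUnion fun x => G.neighborFinset x

variable {G} {P : W → Prop} [DecidablePred P]

lemma subset_closedNeighbors (S : Finset W) : S ⊆ G.closedNeighbors P S :=
  Finset.subset_union_left

lemma mem_closedNeighbors_of_adj {S : Finset W} {x y : W} (hx : x ∈ S) (hP : P x)
    (h : G.Adj x y) : y ∈ G.closedNeighbors P S :=
  Finset.mem_union_right _ <| Finset.mem_biUnion.2 ⟨x, by simp [hx, hP], by simpa using h⟩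

lemma mem_iterate_closedNeighbors_of_le {S : Finset W} {x : W} {i j : ℕ} (hij : i ≤ j)
    (hx : x ∈ (G.closedNeighbors P)^[i] S) : x ∈ (G.closedNeighbors P)^[j] S := by
  induction j, hij using Nat.le_induction with
  | base => exact hx
  | succ j _ ih =>
    rw [Function.iterate_succ_apply']
    exact subset_closedNeighbors _ ih

/-- `P` is only asked on the image of `φ`, so the exploration may be confined to vertices of small
degree. -/
lemma Walk.map_mem_iterate_closedNeighbors {V : Type*} {H : SimpleGraph V} (φ : H →g G)
    {a b : V} (w : H.Walk a b) (hP : ∀ c, P (φ c)) (S : Finset W) (ha : φ a ∈ S) :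
    φ b ∈ (G.closedNeighbors P)^[w.length] S := by
  induction w generalizing S with
  | nil => simpa using ha
  | cons h w ih =>
    rw [length_cons, Function.iterate_succ_apply]
    exact ih _ (mem_closedNeighbors_of_adj ha (hP _) (φ.map_adj h))

lemma card_closedNeighbors_le {d : ℕ} (hP : ∀ x, P x → G.degree x ≤ d) (S : Finset W) :
    (G.closedNeighbors P S).card ≤ (d + 1) * S.card := by
  calc (G.closedNeighbors P S).card
      ≤ S.card + ((S.filter P).biUnion fun x => G.neighborFinset x).card := Finset.card_union_le _ _
    _ ≤ S.card + (S.filter P).card * d := by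
        gcongr
        refine Finset.card_biUnion_le_card_mul _ _ _ fun x hx => ?_
        rw [card_neighborFinset_eq_degree]
        exact hP x (Finset.mem_filter.1 hx).2
    _ ≤ S.card + S.card * d := by gcongr; exact Finset.filter_subset _ _
    _ = (d + 1) * S.card := by ring

lemma card_iterate_closedNeighbors_le {d : ℕ} (hP : ∀ x, P x → G.degree x ≤ d) (S : Finset W)
    (j : ℕ) : ((G.closedNeighbors P)^[j] S).card ≤ (d + 1) ^ j * S.card := by
  induction j with
  | zero => simp
  | succ j ih =>
    rw [Function.iterate_succ_apply', pow_succ', mul_assoc]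
    exact (card_closedNeighbors_le hP _).trans (by gcongr)

/-- The new vertices number at most the degree sum of `S`, and each has degree at most `d`. Degrees
inside `S` may be arbitrarily large. -/
lemma sum_degree_closedNeighbors_le {d : ℕ} (S : Finset W) (hS : ∀ x ∉ S, G.degree x ≤ d) :
    ∑ x ∈ G.closedNeighbors P S, G.degree x ≤ (d + 1) * ∑ x ∈ S, G.degree x := by
  have hN : ((S.filter P).biUnion fun x => G.neighborFinset x).card ≤ ∑ x ∈ S, G.degree x := by
    refine Finset.card_biUnion_le.trans ?_
    simp only [card_neighborFinset_eq_degree]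
    exact Finset.sum_le_sum_of_subset (Finset.filter_subset _ _)
  have hsplit : G.closedNeighbors P S = S ∪ (((S.filter P).biUnion fun x => G.neighborFinset x) \ S) := by
    simp [closedNeighbors]
  rw [hsplit, Finset.sum_union Finset.disjoint_sdiff, add_mul, one_mul, add_comm]
  gcongr
  calc _ ≤ (((S.filter P).biUnion fun x => G.neighborFinset x) \ S).card • d :=
        Finset.sum_le_card_nsmul _ _ _ fun x hx => hS x (Finset.mem_sdiff.1 hx).2
    _ ≤ (∑ x ∈ S, G.degree x) * d := by
        rw [smul_eq_mul]
        gcongr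
        exact (Finset.card_le_card Finset.sdiff_subset).trans hN
    _ = _ := mul_comm _ _

lemma sum_degree_iterate_closedNeighbors_le {d : ℕ} (S : Finset W)
    (hS : ∀ x ∉ S, G.degree x ≤ d) (j : ℕ) :
    ∑ x ∈ (G.closedNeighbors P)^[j] S, G.degree x ≤ (d + 1) ^ j * ∑ x ∈ S, G.degree x := by
  induction j with
  | zero => simp
  | succ j ih =>
    rw [Function.iterate_succ_apply', pow_succ', mul_assoc]
    refine (sum_degree_closedNeighbors_le _ fun x hx => hS x fun h => hx ?_).trans (by gcongr)
    exact mem_iterate_closedNeighbors_of_le (Nat.zero_le j) h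

/-- If every edge has an endpoint in `S`, then `S` carries at least as much degree as there are
edges. -/
lemma card_edgeFinset_le_sum_degree (S : Finset W) (hS : ∀ e ∈ G.edgeSet, ∃ x ∈ S, x ∈ e) :
    G.edgeFinset.card ≤ ∑ x ∈ S, G.degree x := by
  have : G.edgeFinset ⊆ S.biUnion fun x => G.incidenceFinset x := by
    intro e he
    rw [mem_edgeFinset] at he
    obtain ⟨x, hx, hxe⟩ := hS e he
    exact Finset.mem_biUnion.2 ⟨x, hx, by simpa using ⟨he, hxe⟩⟩
  refine (Finset.card_le_card this).trans (Finset.card_biUnion_le.trans ?_)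
  simp

end Neighborhoods

/-! ### Many copies through each edge force few non-isolated vertices. -/

section Copies

variable {V W : Type*} [Fintype V] [Fintype W] {H : SimpleGraph V} {G : SimpleGraph W} {d : ℕ}

/-- An upper bound for the number of labelled copies of a connected graph on `v` vertices through
an edge whose neighbourhood has degrees at most `d`. -/
def localCopyBound (v d : ℕ) : ℕ := ((d + 1) ^ v) ^ v

lemma exists_walk_length_le_card (hconn : H.Connected) (a b : V) :
    ∃ w : H.Walk a b, w.length ≤ Fintype.card V := by
  classical
  obtain ⟨p⟩ := hconn.preconnected a b
  exact ⟨p.toPath, (p.toPath.2.length_lt).le⟩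

/-- If the copies through `e` cannot reach a vertex of degree more than `d`, then there are only
boundedly many. -/
lemma labelledCopyCountThrough_le [DecidableEq W] [DecidableRel G.Adj] (hconn : H.Connected)
    {e : Sym2 W} (x : W) (hx : x ∈ e)
    (hxU : x ∉ (G.closedNeighbors fun _ => True)^[Fintype.card V]
      (Finset.univ.filter fun y => d < G.degree y)) :
    labelledCopyCountThrough H G e ≤ localCopyBound (Fintype.card V) d := by
  classical
  set v := Fintype.card V
  set U : Finset W := Finset.univ.filter fun y => d < G.degree y with hU
  set T : Finset W := (G.closedNeighbors fun y => G.degree y ≤ d)^[v] {x} with hT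
  have hcopy : ∀ φ : Copy H G, (∃ a b : V, H.Adj a b ∧ s(φ a, φ b) = e) → ∀ c, φ c ∈ T := by
    rintro φ ⟨a₁, b₁, hab, he⟩
    obtain ⟨a, ha⟩ : ∃ a, φ a = x := by
      rw [← he, Sym2.mem_iff] at hx
      rcases hx with h | h
      exacts [⟨_, h.symm⟩, ⟨_, h.symm⟩]
    -- A vertex of large degree in the copy would be joined to `x` by the image of a short walk in
    -- `H`, against `hxU`.
    have hlow : ∀ c, G.degree (φ c) ≤ d := by
      intro c
      by_contra! hc
      apply hxU
      obtain ⟨w, hw⟩ := exists_walk_length_le_card hconn c a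
      have := w.map_mem_iterate_closedNeighbors (P := fun _ => True) φ.toHom (fun _ => trivial) U
        (by simpa [hU] using hc)
      rw [← ha]
      exact mem_iterate_closedNeighbors_of_le hw this
    intro c
    obtain ⟨w, hw⟩ := exists_walk_length_le_card hconn a c
    have := w.map_mem_iterate_closedNeighbors (P := fun y => G.degree y ≤ d) φ.toHom hlow {x}
      (by simp [ha])
    exact mem_iterate_closedNeighbors_of_le hw this
  have hTcard : T.card ≤ (d + 1) ^ v := by
    simpa using card_iterate_closedNeighbors_le (G := G) (P := fun y => G.degree y ≤ d)
      (fun _ h => h) {x} v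
  calc labelledCopyCountThrough H G e
      ≤ Nat.card (V → T) := by
        refine Nat.card_le_card_of_injective (fun φ c => ⟨φ.1 c, hcopy φ.1 φ.2 c⟩) ?_
        intro φ ψ h
        ext c
        simpa using congrArg Subtype.val (congrFun h c)
    _ = T.card ^ v := by simp [Nat.card_eq_fintype_card, v]
    _ ≤ _ := by unfold localCopyBound; gcongr

/-- A lower bound for the number of edges of a graph in terms of its number of non-isolated
vertices, when every edge is in many copies of `H`: it beats the trivial bound `Δ k ≤ 2 m`. -/
theorem support_ncard_le [DecidableRel H.Adj] (hconn : H.Connected)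
    (hreg : H.IsRegularOfDegree d)
    (hG : ∀ e ∈ G.edgeSet, localCopyBound (Fintype.card V) d < labelledCopyCountThrough H G e) :
    (d + 1) ^ (Fintype.card V + 1) * (d * G.support.ncard) + G.edgeSet.ncard ≤
      (d + 1) ^ (Fintype.card V + 1) * (2 * G.edgeSet.ncard) := by
  classical
  set v := Fintype.card V
  set U : Finset W := Finset.univ.filter fun y => d < G.degree y with hU
  set X : Finset W := G.support.toFinset with hX
  have hm : G.edgeSet.ncard = G.edgeFinset.card := by
    rw [← coe_edgeFinset, Set.ncard_coe_finset]
  -- A non-isolated vertex lies in a copy of the `d`-regular graph `H`.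
  have hdeg : ∀ x ∈ X, d ≤ G.degree x := by
    intro x hx
    obtain ⟨y, hxy⟩ := G.mem_support.1 (Set.mem_toFinset.1 hx)
    have hpos : 0 < labelledCopyCountThrough H G s(x, y) := (Nat.zero_le _).trans_lt (hG _ hxy)
    obtain ⟨⟨φ, a, b, hab, he⟩⟩ := (Nat.card_pos_iff.1 hpos).1
    obtain ⟨c, rfl⟩ : ∃ c, φ c = x := by
      have : x ∈ s(φ a, φ b) := by rw [he]; simp
      rw [Sym2.mem_iff] at this
      rcases this with h | h
      exacts [⟨_, h.symm⟩, ⟨_, h.symm⟩]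
    have := φ.degree_le c
    rwa [hreg.degree_eq c] at this
  have hcover : ∀ e ∈ G.edgeSet,
      ∃ x ∈ (G.closedNeighbors fun _ => True)^[v] U, x ∈ e := by
    intro e he
    induction e with
    | _ x y =>
    refine ⟨x, ?_, by simp⟩
    by_contra hxU
    exact (hG _ he).not_ge (labelledCopyCountThrough_le hconn x (by simp) hxU)
  have hUX : U ⊆ X := by
    intro x hx
    have : 0 < G.degree x := (Nat.zero_le _).trans_lt (Finset.mem_filter.1 hx).2
    obtain ⟨y, hy⟩ := (G.degree_pos_iff_exists_adj x).1 this
    exact Set.mem_toFinset.2 ⟨y, hy⟩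
  have hsum : ∑ x ∈ X, G.degree x = 2 * G.edgeFinset.card := by
    rw [← G.sum_degrees_eq_twice_card_edges]
    refine Finset.sum_subset (Finset.subset_univ _) fun x _ hx => ?_
    by_contra h
    obtain ⟨y, hy⟩ := (G.degree_pos_iff_exists_adj x).1 (Nat.pos_of_ne_zero h)
    exact hx (Set.mem_toFinset.2 ⟨y, hy⟩)
  -- A degree D ≥ d + 1 satisfies D ≤ (d + 1)(D - d): on `U` the excess over d is a fixed proportion
  -- of the degree.
  have hexcess : ∑ x ∈ U, G.degree x + (d + 1) * (d * X.card) ≤ (d + 1) * ∑ x ∈ X, G.degree x := by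
    have h1 : ∑ _x ∈ X, (d + 1) * d + ∑ x ∈ U, G.degree x ≤ ∑ x ∈ X, (d + 1) * G.degree x := by
      rw [← Finset.sum_sdiff hUX, ← Finset.sum_sdiff hUX (f := fun x => (d + 1) * G.degree x),
        add_assoc, ← Finset.sum_add_distrib]
      refine add_le_add (Finset.sum_le_sum fun x hx => ?_) (Finset.sum_le_sum fun x hx => ?_)
      · have := hdeg x (Finset.mem_sdiff.1 hx).1
        gcongr
      · have : d + 1 ≤ G.degree x := (Finset.mem_filter.1 hx).2
        nlinarith
    rw [Finset.sum_const, smul_eq_mul, ← Finset.mul_sum] at h1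
    calc _ = X.card * ((d + 1) * d) + ∑ x ∈ U, G.degree x := by ring
      _ ≤ _ := h1
  have hedges := card_edgeFinset_le_sum_degree _ hcover
  have hgrow := sum_degree_iterate_closedNeighbors_le (G := G) (P := fun _ => True) (d := d) U
    (fun x hx => by simpa [hU] using hx) v
  have hXcard : G.support.ncard = X.card := by
    rw [hX, Set.ncard_eq_toFinset_card']
  rw [hm, hXcard, ← hsum]
  calc _ ≤ (d + 1) ^ (v + 1) * (d * X.card) + (d + 1) ^ v * ∑ x ∈ U, G.degree x := by
        gcongr; exact hedges.trans hgrow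
    _ = (d + 1) ^ v * (∑ x ∈ U, G.degree x + (d + 1) * (d * X.card)) := by ring
    _ ≤ (d + 1) ^ v * ((d + 1) * ∑ x ∈ X, G.degree x) := by gcongr
    _ = _ := by ring

end Copies

open MeasureTheory ProbabilityTheory

/-! ### Counting graphs by edges and support. -/

section Counting

/-- There are few graphs with `m` edges and at most `K` non-isolated vertices. -/
lemma ncard_edges_support_le {W : Type*} [Fintype W] {K m : ℕ} (hm : 0 < m) :
    {G : SimpleGraph W | G.edgeSet.ncard = m ∧ G.support.ncard ≤ K}.ncard ≤
      Fintype.card W ^ K * (K * K) ^ m := by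
  classical
  -- A graph is encoded by a list of `K` vertices covering its support and, for each edge, the
  -- positions of its two ends.
  let F : (Fin K → W) × (Fin m → Fin K × Fin K) → SimpleGraph W := fun gh =>
    fromEdgeSet (Set.range fun i => s(gh.1 (gh.2 i).1, gh.1 (gh.2 i).2))
  have hsub : {G : SimpleGraph W | G.edgeSet.ncard = m ∧ G.support.ncard ≤ K} ⊆ Set.range F := by
    rintro G ⟨hGm, hGK⟩
    have hne : G.support.Nonempty := by
      obtain ⟨e, he⟩ := Set.nonempty_of_ncard_ne_zero (by omega : G.edgeSet.ncard ≠ 0)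
      induction e with
      | _ x y => exact ⟨x, y, he⟩
    obtain ⟨g, hg⟩ : ∃ g : Fin K → W, G.support ⊆ Set.range g := by
      obtain ⟨x₀, -⟩ := hne
      let f := (Finite.equivFin G.support).symm
      rw [← Nat.card_coe_set_eq] at hGK
      refine ⟨fun i => if h : i.1 < Nat.card G.support then f ⟨i.1, h⟩ else x₀, fun x hx => ?_⟩
      refine ⟨Fin.castLE hGK (f.symm ⟨x, hx⟩), (dif_pos (f.symm ⟨x, hx⟩).2).trans ?_⟩
      exact congrArg Subtype.val (f.apply_symm_apply ⟨x, hx⟩)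
    let k : Fin m ≃ G.edgeSet := (Finite.equivFinOfCardEq (by rw [Nat.card_coe_set_eq, hGm])).symm
    have hk : ∀ e : G.edgeSet, ∃ ij : Fin K × Fin K, s(g ij.1, g ij.2) = e.1 := by
      rintro ⟨e, he⟩
      induction e with
      | _ x y =>
      obtain ⟨i, hi⟩ := hg (⟨y, he⟩ : x ∈ G.support)
      obtain ⟨j, hj⟩ := hg (⟨x, G.adj_symm he⟩ : y ∈ G.support)
      exact ⟨(i, j), by simp [hi, hj]⟩
    choose h hh using hk
    refine ⟨(g, fun i => h (k i)), ?_⟩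
    have : Set.range (fun i => s(g (h (k i)).1, g (h (k i)).2)) = G.edgeSet := by
      ext e
      constructor
      · rintro ⟨i, rfl⟩
        simp only [hh (k i), Subtype.coe_prop]
      · intro he
        refine ⟨k.symm ⟨e, he⟩, ?_⟩
        simp [hh]
    simp only [F, this, fromEdgeSet_edgeSet]
  calc _ ≤ (Set.range F).ncard := Set.ncard_le_ncard hsub (Set.toFinite _)
    _ ≤ Nat.card ((Fin K → W) × (Fin m → Fin K × Fin K)) := by
        rw [← Set.image_univ, ← Set.ncard_univ]
        exact Set.ncard_image_le (Set.toFinite _)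
    _ = _ := by simp [Nat.card_eq_fintype_card]

end Counting

/-! ### Containment probabilities and the union bound. -/

section Probability

/-- The probability that the binomial random graph contains a given graph. -/
lemma binomialRandom_le_of_le {W : Type*} [Fintype W] (p : unitInterval) (G : SimpleGraph W) :
    binomialRandom W p {Γ | G ≤ Γ} ≤ ENNReal.ofReal ((p : ℝ) ^ G.edgeSet.ncard) := by
  classical
  rw [binomialRandom_apply']
  have hsub : edgeSet '' {Γ : SimpleGraph W | G ≤ Γ} ⊆ {s | G.edgeSet ⊆ s} := by
    rintro _ ⟨Γ, hΓ, rfl⟩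
    exact edgeSet_mono hΓ
  refine (measure_mono hsub).trans ?_
  rw [setBernoulli_apply']
  have : (fun q : Sym2 W → Prop => {i | q i}) ⁻¹' {s | G.edgeSet ⊆ s} =
      Set.pi (G.edgeFinset : Set (Sym2 W)) (fun _ => {q : Prop | q}) := by
    ext q
    simp [Set.subset_def, Set.mem_pi]
  rw [this, Measure.infinitePi_pi _ (fun _ _ => .of_discrete)]
  have hm : G.edgeSet.ncard = G.edgeFinset.card := by
    rw [← coe_edgeFinset, Set.ncard_coe_finset]
  rw [hm, ENNReal.ofReal_pow p.2.1, ← Finset.prod_const]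
  refine Finset.prod_le_prod' fun e he => ?_
  have hd : ¬ e.IsDiag := G.not_isDiag_of_mem_edgeSet (by simpa using he)
  have hpe : ENNReal.ofReal (p : ℝ) = unitInterval.toNNReal p :=
    ENNReal.ofReal_eq_coe_nnreal p.2.1
  simp [hd, hpe]

/-- Union bound over a family of graphs, sorted by their numbers of edges. -/
lemma binomialRandom_exists_le {W : Type*} [Fintype W] (p : unitInterval)
    (𝒞 : Set (SimpleGraph W)) (M : ℕ) (hM : ∀ G ∈ 𝒞, G.edgeSet.ncard ≤ M) {r : ℝ}
    (h : ∀ m ≤ M, ({G ∈ 𝒞 | G.edgeSet.ncard = m}.ncard : ℝ) * (p : ℝ) ^ m ≤ r) :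
    binomialRandom W p {Γ | ∃ G ≤ Γ, G ∈ 𝒞} ≤ ENNReal.ofReal ((M + 1) * r) := by
  classical
  let A : ℕ → Finset (SimpleGraph W) := fun m =>
    (Set.toFinite {G ∈ 𝒞 | G.edgeSet.ncard = m}).toFinset
  have hsub : {Γ | ∃ G ≤ Γ, G ∈ 𝒞} ⊆
      ⋃ m ∈ Finset.range (M + 1), ⋃ G ∈ A m, {Γ | G ≤ Γ} := by
    rintro Γ ⟨G, hG, hG𝒞⟩
    simp only [Set.mem_iUnion]
    exact ⟨_, Finset.mem_range.2 (Nat.lt_succ_of_le (hM G hG𝒞)), G, by simpa [A] using hG𝒞, hG⟩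
  have hA : ∀ m ∈ Finset.range (M + 1),
      binomialRandom W p (⋃ G ∈ A m, {Γ | G ≤ Γ}) ≤ ENNReal.ofReal r := by
    intro m hm
    refine (measure_biUnion_finset_le _ _).trans ?_
    calc _ ≤ ∑ G ∈ A m, ENNReal.ofReal ((p : ℝ) ^ m) := by
          refine Finset.sum_le_sum fun G hG => ?_
          have : G.edgeSet.ncard = m := by
            have := (Set.Finite.mem_toFinset _).1 hG
            exact this.2
          exact this ▸ binomialRandom_le_of_le p G
      _ = ENNReal.ofReal ((A m).card * (p : ℝ) ^ m) := by
          rw [Finset.sum_const, nsmul_eq_mul, ENNReal.ofReal_mul (by positivity)]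
          simp
      _ ≤ _ := by
          refine ENNReal.ofReal_le_ofReal (le_trans (le_of_eq ?_)
            (h m (Nat.lt_succ_iff.1 (Finset.mem_range.1 hm))))
          rw [Set.ncard_eq_toFinset_card _ (Set.toFinite _)]
  refine (measure_mono hsub).trans ((measure_biUnion_finset_le _ _).trans ?_)
  refine (Finset.sum_le_sum hA).trans (le_of_eq ?_)
  rw [Finset.sum_const, nsmul_eq_mul, ENNReal.ofReal_mul (by positivity), Finset.card_range]
  norm_cast

end Probability

/-! ### The union bound for core graphs. -/

/-- The exponential form of the union bound for graphs with `m` edges and `K` vertices. -/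
lemma pow_mul_pow_mul_pow_le_exp {n K m q d v A : ℕ} {p ℓ lam : ℝ} (hn : 0 < n) (hm : 0 < m)
    (hq : 0 < q) (hd : 2 ≤ d) (hp : 0 < p) (hℓ : Real.log n = ℓ) (hℓ0 : 0 ≤ ℓ) (hlam : 0 ≤ lam)
    (hK : q * (d * K) + m ≤ q * (2 * m)) (hmA : (m : ℝ) ≤ Real.exp (A * lam))
    (hpL : 2 / d * (ℓ - v * lam) ≤ Real.log (1 / p))
    (hsmall : (2 * A + 2 * v) * lam ≤ 1 / (2 * (q * d)) * ℓ) :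
    (n : ℝ) ^ K * ((K : ℝ) * K) ^ m * p ^ m ≤ Real.exp (-(m * (1 / (2 * (q * d)) * ℓ))) := by
  have hd' : (2 : ℝ) ≤ d := by exact_mod_cast hd
  have hq' : (0 : ℝ) < q := by exact_mod_cast hq
  have hKm : K ≤ m := by
    have : q * (2 * K) ≤ q * (2 * m) := by
      have : q * (2 * K) ≤ q * (d * K) := by gcongr
      omega
    have := Nat.le_of_mul_le_mul_left this hq
    omega
  have hKe : (K : ℝ) ≤ Real.exp (A * lam) := le_trans (by exact_mod_cast hKm) hmA
  have hnexp : (n : ℝ) = Real.exp ℓ := by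
    rw [← hℓ, Real.exp_log (by exact_mod_cast hn)]
  have hpexp : p ≤ Real.exp (-(2 / d * (ℓ - v * lam))) := by
    rw [← Real.log_le_iff_le_exp hp]
    rw [one_div, Real.log_inv] at hpL
    linarith
  have hKR : (K : ℝ) ≤ (2 - 1 / q) * m / d := by
    have h : (q : ℝ) * (d * K) + m ≤ q * (2 * m) := by exact_mod_cast hK
    rw [le_div_iff₀ (by linarith)]
    have e : (2 - 1 / (q : ℝ)) * m = (q * (2 * m) - m) / q := by field_simp
    rw [e, le_div_iff₀ hq']
    linarith
  calc (n : ℝ) ^ K * ((K : ℝ) * K) ^ m * p ^ m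
      ≤ Real.exp ℓ ^ K * (Real.exp (A * lam) * Real.exp (A * lam)) ^ m *
        Real.exp (-(2 / d * (ℓ - v * lam))) ^ m := by rw [hnexp]; gcongr
    _ = Real.exp (K * ℓ + m * (2 * A * lam) - m * (2 / d * (ℓ - v * lam))) := by
        rw [← Real.exp_add, ← Real.exp_nat_mul, ← Real.exp_nat_mul, ← Real.exp_nat_mul,
          ← Real.exp_add, ← Real.exp_add]
        ring_nf
    _ ≤ _ := by
        rw [Real.exp_le_exp]
        -- The term 1/q saves mℓ/(qd); half of it absorbs the `lam` errors and half remains.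
        have h1 : (K : ℝ) * ℓ ≤ (2 - 1 / q) * m / d * ℓ := by gcongr
        have h2 : 2 / (d : ℝ) * (v * lam) ≤ 2 * v * lam := by
          have : 2 / (d : ℝ) ≤ 2 := by rw [div_le_iff₀ (by linarith)]; linarith
          calc 2 / (d : ℝ) * (v * lam) ≤ 2 * (v * lam) := by gcongr
            _ = _ := by ring
        have h3 : (m : ℝ) * ((2 * A + 2 * v) * lam) ≤ m * (1 / (2 * (q * d)) * ℓ) := by gcongr
        have h4 : (m : ℝ) * (2 / (d : ℝ) * (v * lam)) ≤ m * (2 * v * lam) := by gcongr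
        have h5 : (2 - 1 / (q : ℝ)) * m / d * ℓ =
            m * (2 / d * ℓ) - 2 * (m * (1 / (2 * (q * d)) * ℓ)) := by
          field_simp
        linarith

/-- A bound for the probability of containing a core graph with at least `m₀` edges, for
parameters that satisfy the listed numerical inequalities. -/
theorem binomialRandom_coreEvent_le {V : Type*} [Fintype V] {H : SimpleGraph V}
    [DecidableRel H.Adj] {d n A : ℕ} (hd : 2 ≤ d) (hconn : H.Connected)
    (hreg : H.IsRegularOfDegree d) {p : unitInterval} (hp : 0 < (p : ℝ)) {δ ε C ℓ lam a : ℝ}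
    (hn : 0 < n) (hℓ : Real.log n = ℓ) (hlam : Real.log ℓ = lam) (hℓ0 : 0 ≤ ℓ) (hlam0 : 0 < lam)
    (ha : a = 1 / (2 * (((d + 1) ^ (Fintype.card V + 1) : ℕ) * d)))
    (hcopies : (localCopyBound (Fintype.card V) d : ℝ) <
      δ * ε * (n : ℝ) ^ Fintype.card V * (p : ℝ) ^ H.edgeSet.ncard / coreEdgeBound d n p C)
    (hB : coreEdgeBound d n p C + 1 ≤ Real.exp (A * lam))
    (hpL : 2 / d * (ℓ - Fintype.card V * lam) ≤ Real.log (1 / p))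
    (hsmall : (2 * A + 2 * Fintype.card V) * lam ≤ a * ℓ)
    (hmany : 1 ≤ coreEdgeBound d n p C / lam ^ 2) :
    binomialRandom (Fin n) p (coreEvent H d n p δ ε C) ≤
      ENNReal.ofReal (Real.exp (-(a / 2 * ℓ * (coreEdgeBound d n p C / lam ^ 2)))) := by
  set v := Fintype.card V
  set B := coreEdgeBound d n p C
  have hB0 : 0 ≤ B := by
    by_contra! h
    have : B / lam ^ 2 ≤ 0 := div_nonpos_of_nonpos_of_nonneg h.le (by positivity)
    linarith
  have ha0 : 0 ≤ a := by rw [ha]; positivity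
  let 𝒞 : Set (SimpleGraph (Fin n)) := {G | IsCoreGraph H d n p δ ε C G ∧
    B / Real.log (Real.log n) ^ 2 ≤ (G.edgeSet.ncard : ℝ) ∧ (G.edgeSet.ncard : ℝ) ≤ B}
  have h𝒞 : ∀ G ∈ 𝒞, G.edgeSet.ncard ≤ ⌊B⌋₊ := fun G hG => Nat.le_floor hG.2.2
  have hmain := binomialRandom_exists_le p 𝒞 ⌊B⌋₊ h𝒞
    (r := Real.exp (-(B / lam ^ 2 * (a * ℓ))))
  refine (le_trans ?_ (hmain ?_)).trans (ENNReal.ofReal_le_ofReal ?_)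
  · exact measure_mono fun Γ ⟨G, hG, h⟩ => ⟨G, hG, h⟩
  · intro m hm
    rcases Set.eq_empty_or_nonempty {G ∈ 𝒞 | G.edgeSet.ncard = m} with hempty | ⟨G₀, hG₀, hG₀m⟩
    · rw [hempty]
      simp only [Set.ncard_empty, Nat.cast_zero, zero_mul]
      positivity
    have hm0 : B / lam ^ 2 ≤ m := by
      have := hG₀.2.1
      rwa [hG₀m, hℓ, hlam] at this
    have hmpos : 0 < m := by
      have : (0 : ℝ) < m := by linarith
      exact_mod_cast this
    set q := (d + 1) ^ (v + 1) with hq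
    set K := (q * (2 * m) - m) / (q * d) with hK
    have hqpos : 0 < q := by positivity
    have hmq : m ≤ q * (2 * m) := by nlinarith
    have hKle : q * (d * K) + m ≤ q * (2 * m) := by
      have : K * (q * d) ≤ q * (2 * m) - m := Nat.div_mul_le_self _ _
      have e : q * (d * K) = K * (q * d) := by ring
      omega
    have hsub : {G ∈ 𝒞 | G.edgeSet.ncard = m} ⊆
        {G : SimpleGraph (Fin n) | G.edgeSet.ncard = m ∧ G.support.ncard ≤ K} := by
      rintro G ⟨hG, hGm⟩
      refine ⟨hGm, ?_⟩
      have := support_ncard_le (G := G) hconn hreg fun e he => by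
        have := hcopies.trans_le (hG.1.copies_through e he)
        exact_mod_cast this
      rw [hGm] at this
      change q * (d * G.support.ncard) + m ≤ q * (2 * m) at this
      rw [hK, Nat.le_div_iff_mul_le (by positivity)]
      have e : q * (d * G.support.ncard) = G.support.ncard * (q * d) := by ring
      omega
    have hcount : ({G ∈ 𝒞 | G.edgeSet.ncard = m}.ncard : ℝ) ≤ (n : ℝ) ^ K * ((K : ℝ) * K) ^ m := by
      have := (Set.ncard_le_ncard hsub (Set.toFinite _)).trans (ncard_edges_support_le hmpos)
      rw [Fintype.card_fin] at this
      exact_mod_cast this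
    have hmB : (m : ℝ) ≤ B := (Nat.le_floor_iff hB0).1 hm
    calc _ ≤ (n : ℝ) ^ K * ((K : ℝ) * K) ^ m * (p : ℝ) ^ m := by gcongr
      _ ≤ Real.exp (-(m * (1 / (2 * (q * d)) * ℓ))) :=
          pow_mul_pow_mul_pow_le_exp hn hmpos hqpos hd hp hℓ hℓ0 hlam0.le hKle (by linarith) hpL
            (by rw [← ha]; exact hsmall)
      _ ≤ _ := by
          rw [← ha, Real.exp_le_exp]
          gcongr
  -- The number of possible values of m costs at most half of the exponent, because B / lam^2 ≥ 1.
  · calc ((⌊B⌋₊ : ℝ) + 1) * Real.exp (-(B / lam ^ 2 * (a * ℓ)))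
        ≤ Real.exp (A * lam) * Real.exp (-(B / lam ^ 2 * (a * ℓ))) := by
          gcongr
          have := Nat.floor_le hB0
          linarith
      _ ≤ _ := by
          rw [← Real.exp_add, Real.exp_le_exp]
          have h1 : 1 * (a * ℓ) ≤ B / lam ^ 2 * (a * ℓ) := by gcongr
          have h2 : 0 ≤ (v : ℝ) * lam := by positivity
          nlinarith

/-! ### Asymptotics of the parameters. -/

lemma IsRegularOfDegree.two_mul_ncard_edgeSet {V : Type*} [Fintype V] {H : SimpleGraph V}
    [DecidableRel H.Adj] {d : ℕ} (hreg : H.IsRegularOfDegree d) :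
    2 * H.edgeSet.ncard = d * Fintype.card V := by
  classical
  have h := H.sum_degrees_eq_twice_card_edges
  have hm : H.edgeSet.ncard = H.edgeFinset.card := by
    rw [← coe_edgeFinset, Set.ncard_coe_finset]
  rw [hm, ← h, Finset.sum_congr rfl fun x _ => hreg.degree_eq x]
  simp [mul_comm]

/-- The numerical hypotheses of `binomialRandom_coreEvent_le` hold for large `n`. -/
lemma eventually_core_numerics {v d e : ℕ} (hd : 2 ≤ d) (hv : 3 ≤ v) (he : 2 * e = d * v)
    {p : ℕ → ℝ} (hp : ∀ n, 0 < p n ∧ p n < 1)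
    (hlow : (fun n : ℕ => Real.log n ^ (1 / ((v : ℝ) - 2))) =o[atTop]
      (fun n : ℕ => (n : ℝ) * p n ^ ((d : ℝ) / 2)))
    (hupp : ∀ᶠ n : ℕ in atTop, (n : ℝ) * p n ^ ((d : ℝ) / 2) ≤ Real.log n ^ v)
    {η C a : ℝ} (hη : 0 < η) (hC : 0 < C) (ha : 0 < a) (R : ℕ) (T : ℝ) :
    ∀ᶠ n : ℕ in atTop, 0 < n ∧ 0 ≤ Real.log n ∧ 0 < Real.log (Real.log n) ∧
      (R : ℝ) < η * (n : ℝ) ^ v * p n ^ e / coreEdgeBound d n (p n) C ∧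
      coreEdgeBound d n (p n) C + 1 ≤
        Real.exp ((2 * v + 2 : ℕ) * Real.log (Real.log n)) ∧
      2 / d * (Real.log n - v * Real.log (Real.log n)) ≤ Real.log (1 / p n) ∧
      (2 * (2 * v + 2 : ℕ) + 2 * v) * Real.log (Real.log n) ≤ a * Real.log n ∧
      1 ≤ coreEdgeBound d n (p n) C / Real.log (Real.log n) ^ 2 ∧
      0 < (n : ℝ) ^ 2 * p n ^ d * Real.log (1 / p n) ∧
      T * ((n : ℝ) ^ 2 * p n ^ d * Real.log (1 / p n)) ≤
        a / 2 * Real.log n * (coreEdgeBound d n (p n) C / Real.log (Real.log n) ^ 2) := by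
  have hℓ : Tendsto (fun n : ℕ => Real.log n) atTop atTop :=
    Real.tendsto_log_atTop.comp tendsto_natCast_atTop_atTop
  have hlam := Real.tendsto_log_atTop.comp hℓ
  have hpow (k : ℕ) {κ : ℝ} (hκ : 0 < κ) :
      ∀ᶠ n : ℕ in atTop, |Real.log (Real.log n) ^ k| ≤ κ * |Real.log n| := by
    simpa using ((Real.isLittleO_pow_log_id_atTop (n := k)).comp_tendsto hℓ).def hκ
  have hd' : (2 : ℝ) ≤ d := by exact_mod_cast hd
  have hv' : (3 : ℝ) ≤ v := by exact_mod_cast hv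
  -- Chosen so that raising ℓ^(1/(v-2)) ≤ c s to the power v - 2 gives C (R + 1) ℓ ≤ η s^(v-2).
  set c := (η / (C * (R + 1))) ^ (1 / ((v : ℝ) - 2)) with hc
  have hc0 : 0 < c := by positivity
  set A : ℝ := 2 * (2 * v + 2 : ℕ) + 2 * v with hA
  have hA0 : 0 < A := by positivity
  filter_upwards [eventually_gt_atTop 0, hℓ.eventually_ge_atTop (C + 1),
    hlam.eventually_ge_atTop 1, hlow.def hc0, hlow.def one_pos, hupp, hpow 1 (div_pos ha hA0),
    hpow 1 (by positivity : 0 < 1 / (2 * (v : ℝ))), hpow 2 (by positivity : 0 < C / d),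
    hpow 2 (by positivity : 0 < a / 2 * C / (|T| + 1))]
    with n hn hℓC hlam1 hs1 hs2 hs3 hA1 hv1 hC2 hT2
  obtain ⟨hp0, hp1⟩ := hp n
  generalize hpn : p n = P at *
  generalize hℓn : Real.log n = ℓ at *
  simp only [Function.comp_apply, hℓn] at hlam1
  generalize hlamn : Real.log ℓ = lam at *
  set s : ℝ := (n : ℝ) * P ^ ((d : ℝ) / 2) with hs
  have hn' : (0 : ℝ) < n := by exact_mod_cast hn
  have hs0 : 0 < s := by positivity
  have hℓ1 : 1 ≤ ℓ := by linarith
  have hℓ0 : 0 < ℓ := by linarith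
  have hlam0 : 0 < lam := by linarith
  rw [Real.norm_of_nonneg (by positivity), Real.norm_of_nonneg hs0.le] at hs1 hs2
  rw [abs_of_nonneg (by positivity), abs_of_pos hℓ0] at hA1 hv1 hC2 hT2
  rw [pow_one] at hA1 hv1
  have hv2 : (0 : ℝ) < v - 2 := by linarith
  set L := Real.log (1 / P) with hL
  have hlogs : Real.log s = ℓ - d / 2 * L := by
    rw [hs, Real.log_mul hn'.ne' (by positivity), Real.log_rpow hp0, hℓn, hL, one_div,
      Real.log_inv]
    ring
  have hs_one : 1 ≤ s := by
    have : 1 ≤ ℓ ^ (1 / ((v : ℝ) - 2)) := Real.one_le_rpow hℓ1 (by positivity)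
    linarith
  have hLupp : L ≤ ℓ := by
    have : 0 ≤ Real.log s := Real.log_nonneg hs_one
    have hL0 : 0 ≤ L := Real.log_nonneg (by rw [le_div_iff₀ hp0]; linarith)
    nlinarith
  have hLlow : 2 / d * (ℓ - v * lam) ≤ L := by
    have h := Real.log_le_log hs0 hs3
    rw [Real.log_pow, hlogs, hlamn] at h
    rw [div_mul_eq_mul_div, div_le_iff₀ (by linarith)]
    linarith
  have hLℓ : ℓ / d ≤ L := by
    refine le_trans ?_ hLlow
    have : v * lam ≤ ℓ / 2 := by
      calc v * lam ≤ v * (1 / (2 * v) * ℓ) := by gcongr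
        _ = ℓ / 2 := by field_simp
    rw [div_mul_eq_mul_div]
    gcongr
    linarith
  have hL0 : 0 < L := lt_of_lt_of_le (by positivity) hLℓ
  have hs_sq : (n : ℝ) ^ 2 * P ^ d = s ^ 2 := by
    rw [hs, mul_pow, ← Real.rpow_natCast (P ^ ((d : ℝ) / 2)), ← Real.rpow_mul hp0.le]
    norm_num
  have hs_v : (n : ℝ) ^ v * P ^ e = s ^ v := by
    rw [hs, mul_pow, ← Real.rpow_natCast (P ^ ((d : ℝ) / 2)), ← Real.rpow_mul hp0.le]
    have : (d : ℝ) / 2 * v = e := by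
      have : (2 : ℝ) * e = d * v := by exact_mod_cast he
      linarith
    rw [this, Real.rpow_natCast]
  have hB : coreEdgeBound d n P C = C * (s ^ 2 * L) := by
    rw [coreEdgeBound, ← hs_sq]
    ring
  rw [hB, hs_sq, mul_assoc η, hs_v]
  have hs2one : 1 ≤ s ^ 2 := one_le_pow₀ hs_one
  refine ⟨hn, hℓ0.le, hlam0, ?_, ?_, hLlow, ?_, ?_, by positivity, ?_⟩
  · have hℓs : ℓ ≤ η / (C * (R + 1)) * s ^ (v - 2) := by
      have h := Real.rpow_le_rpow (by positivity) hs1 hv2.le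
      have hcast : ((v - 2 : ℕ) : ℝ) = (v : ℝ) - 2 := by push_cast [(by omega : 2 ≤ v)]; rfl
      rwa [Real.mul_rpow hc0.le hs0.le, hc, ← Real.rpow_mul hℓ0.le,
        ← Real.rpow_mul (by positivity), one_div_mul_cancel hv2.ne', Real.rpow_one, Real.rpow_one,
        ← hcast, Real.rpow_natCast] at h
    have hsplit : s ^ v = s ^ 2 * s ^ (v - 2) := by
      rw [← pow_add]
      congr 1
      omega
    rw [lt_div_iff₀ (by positivity), hsplit]
    have h1 : C * (R + 1) * ℓ ≤ η * s ^ (v - 2) := by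
      rw [div_mul_eq_mul_div, le_div_iff₀ (by positivity)] at hℓs
      linarith
    calc R * (C * (s ^ 2 * L)) = s ^ 2 * (C * R * L) := by ring
      _ < s ^ 2 * (C * (R + 1) * L) := by gcongr; linarith
      _ ≤ s ^ 2 * (C * (R + 1) * ℓ) := by gcongr
      _ ≤ s ^ 2 * (η * s ^ (v - 2)) := by gcongr
      _ = _ := by ring
  · have : Real.exp ((2 * v + 2 : ℕ) * lam) = ℓ ^ (2 * v + 2) := by
      rw [Real.exp_nat_mul, ← hlamn, Real.exp_log hℓ0]
    rw [this]
    -- From s ≤ ℓ^v and L ≤ ℓ the edge bound is at most C ℓ^(2v+1); one more factor ℓ ≥ C + 1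
    -- absorbs the constants.
    have hone : 1 ≤ (ℓ ^ v) ^ 2 * ℓ := by
      rw [← pow_mul, ← pow_succ]
      exact one_le_pow₀ hℓ1
    calc C * (s ^ 2 * L) + 1 ≤ C * ((ℓ ^ v) ^ 2 * ℓ) + (ℓ ^ v) ^ 2 * ℓ := by gcongr
      _ = (C + 1) * ((ℓ ^ v) ^ 2 * ℓ) := by ring
      _ ≤ ℓ * ((ℓ ^ v) ^ 2 * ℓ) := by gcongr
      _ = _ := by ring
  · calc A * lam ≤ A * (a / A * ℓ) := by gcongr
      _ = a * ℓ := by field_simp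
  · rw [le_div_iff₀ (by positivity), one_mul]
    calc lam ^ 2 ≤ C / d * ℓ := hC2
      _ = C * (1 * (ℓ / d)) := by ring
      _ ≤ _ := by gcongr
  · have h1 : T * lam ^ 2 ≤ a / 2 * C * ℓ := by
      calc T * lam ^ 2 ≤ (|T| + 1) * lam ^ 2 := by
            gcongr
            linarith [le_abs_self T]
        _ ≤ (|T| + 1) * (a / 2 * C / (|T| + 1) * ℓ) := by gcongr
        _ = _ := by field_simp
    rw [← mul_div_assoc, le_div_iff₀ (by positivity)]
    calc T * (s ^ 2 * L) * lam ^ 2 = s ^ 2 * L * (T * lam ^ 2) := by ring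
      _ ≤ s ^ 2 * L * (a / 2 * C * ℓ) := by gcongr
      _ = _ := by ring

end SimpleGraph

/-! ### Passage to the upper limit. -/

/-- In this range of edge numbers the union bound over core graphs already gives a probability
`exp (-T n² p ^ Δ log (1 / p))` for every constant `T`, so that `f = 0` is admissible. -/
theorem propositionp {V : Type*} [Fintype V] (H : SimpleGraph V) [DecidableRel H.Adj]
    (Δ : ℕ) (hΔ : 2 ≤ Δ) (hconn : H.Connected) (hreg : H.IsRegularOfDegree Δ) :
    ∃ f : ℝ → ℝ, (∀ ε, 0 ≤ f ε) ∧ Tendsto f (𝓝[>] 0) (𝓝 0) ∧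
      ∀ δ : ℝ, 0 < δ → ∃ ε₀ : ℝ, 0 < ε₀ ∧ ∀ ε : ℝ, 0 < ε → ε < ε₀ →
        ∀ C : ℝ, 0 < C →
        ∀ p : ℕ → unitInterval, (∀ n, 0 < (p n : ℝ) ∧ (p n : ℝ) < 1) →
          ((fun n : ℕ => Real.log n ^ (1 / ((Fintype.card V : ℝ) - 2))) =o[atTop]
            (fun n : ℕ => (n : ℝ) * (p n : ℝ) ^ ((Δ : ℝ) / 2))) →
          (∀ᶠ n : ℕ in atTop,
            (n : ℝ) * (p n : ℝ) ^ ((Δ : ℝ) / 2) ≤ Real.log n ^ Fintype.card V) →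
          limsup (fun n : ℕ =>
              ENNReal.log (SimpleGraph.binomialRandom (Fin n) (p n)
                (coreEvent H Δ n (p n) δ ε C)) /
              (((n : ℝ) ^ 2 * (p n : ℝ) ^ Δ * Real.log (1 / (p n : ℝ)) : ℝ) : EReal)) atTop
            ≤ ((-(1 / 2 * δ ^ (2 / (Fintype.card V : ℝ)) * (1 - f ε)) : ℝ) : EReal) := by
  refine ⟨fun _ => 0, fun _ => le_rfl, tendsto_const_nhds, fun δ hδ => ⟨1, one_pos, ?_⟩⟩
  intro ε hε _ C hC p hp hlow hupp
  -- The value of the rate is irrelevant: any constant `T` would do.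
  generalize hT : 1 / 2 * δ ^ (2 / (Fintype.card V : ℝ)) * (1 - 0) = T
  have hv : 3 ≤ Fintype.card V := by
    obtain ⟨x⟩ := hconn.nonempty
    have := H.degree_lt_card_verts x
    rw [hreg.degree_eq x] at this
    omega
  set a : ℝ := 1 / (2 * (((Δ + 1) ^ (Fintype.card V + 1) : ℕ) * Δ)) with ha
  have ha0 : 0 < a := by positivity
  refine limsup_le_of_le (by isBoundedDefault) ?_
  filter_upwards [SimpleGraph.eventually_core_numerics hΔ hv hreg.two_mul_ncard_edgeSet hp hlow hupp
    (mul_pos hδ hε) hC ha0 (SimpleGraph.localCopyBound (Fintype.card V) Δ) T]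
    with n ⟨hn, hℓ, hlam, hR, hB, hL, hsmall, hmany, hpos, hrate⟩
  have hprob := SimpleGraph.binomialRandom_coreEvent_le hΔ hconn hreg (hp n).1 hn rfl rfl hℓ hlam ha
    hR hB hL hsmall hmany
  have hlog := ENNReal.log_monotone hprob
  have hexp (x : ℝ) : ENNReal.log (ENNReal.ofReal (Real.exp x)) = x := by
    rw [ENNReal.log_ofReal_of_pos (Real.exp_pos x), Real.log_exp]
  rw [hexp] at hlog
  refine (EReal.div_le_div_right_of_nonneg (EReal.coe_nonneg.2 hpos.le) hlog).trans ?_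
  rw [← EReal.coe_div, EReal.coe_le_coe_iff, div_le_iff₀ hpos]
  linarith
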